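/- Let $\Lambda$ be the set of strictly increasing continuous maps of $[0,1]$ onto $[0,1]$, $e$ the identity map, and $\|\lambda\|^0=\sup_{s<s'}\left|\log\frac{\lambda(s')-\lambda(s)}{s'-s}\right|$ for $\lambda\in\Lambda$. Let $\mathbb D$ be the space of right-continuous functions $[0,1]\to\mathbb R$ with left limits, with the metric $$d^0_{J_1}(x,y)=\inf_{\lambda\in\Lambda}\Big\{\|\lambda\|^0\vee\sup_{s\in[0,1]}|x(s)-y(\lambda(s))|\Big\},$$ which induces the $J_1$ topology. Let $\mathbb D([0,1];\mathbb D)$ be the space of functions $x:[0,1]\to\mathbb D$, $x(t)=\{x(t,s)\}_{s\in[0,1]}$, that are right-continuous and have left limits in $\mathbb D$ with respect to the $J_1$ topology, equipped with Whitt's Skorohod distance $$d_{\mathbb D}(x,y)=\inf_{\lambda\in\Lambda}\Big\{\sup_{t\in[0,1]}|\lambda(t)-t|\vee\sup_{t\in[0,1]}d^0_{J_1}\big(x(t),y(\lambda(t))\big)\Big\}$$ and its Borel $\sigma$-field $\mathcal D_{\mathbb D}$. For $x\in\mathbb D([0,1];\mathbb D)$ let $\|x\|_{\mathbb D}=\sup_{t\in[0,1]}\sup_{s\in[0,1]}|x(t,s)|$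 be the super-uniform norm. For $\delta\in(0,1)$, a set $\{t_i\}_{0\le i\le v}$ with $0=t_0<t_1<\dots<t_v=1$ is $\delta$-sparse if $\min_{1\le i\le v}(t_i-t_{i-1})>\delta$. For $y\in\mathbb D$ and $x\in\mathbb D([0,1];\mathbb D)$ put $$w'(y,\delta)=\inf_{\{t_i\}}\max_{1\le i\le v}\ \sup_{s_1,s_2\in[t_{i-1},t_i)}|y(s_1)-y(s_2)|,\qquad w'_{\mathbb D}(x,\delta)=\inf_{\{t_i\}}\max_{1\le i\le v}\ \sup_{r_1,r_2\in[t_{i-1},t_i)}d^0_{J_1}\big(x(r_1),x(r_2)\big),$$ the infima being over all $\delta$-sparse sets. Theorem. A sequence $(P_n)_{n\ge1}$ of probability measures on $(\mathbb D([0,1];\mathbb D),\mathcal D_{\mathbb D})$ is tight (that is, for every $\eta>0$ there is a $d_{\mathbb D}$-compact set $K$ with $P_n(K)\ge1-\eta$ for all $n$) if and only if the following three conditions hold: (i) $\displaystyle\lim_{a\to\infty}\limsup_{n\to\infty}P_n\big(\{x:\|x\|_{\mathbb D}\ge a\}\big)=0$; (ii) for every $\varepsilon>0$, $\displaystyle\lim_{\delta\to0}\limsup_{n\to\infty}P_n\big(\{x: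 w'(x(t),\delta)\ge\varepsilon\text{ for some }t\in[0,1]\}\big)=0$; (iii) for every $\varepsilon>0$, $\displaystyle\lim_{\delta\to0}\limsup_{n\to\infty}P_n\big(\{x: w'_{\mathbb D}(x,\delta)\ge\varepsilon\}\big)=0$. (In (ii), $P_n$ of the event is understood as its outer $P_n$-measure.) -/

import Mathlib

open Set Filter Topology MeasureTheory
open scoped unitInterval ENNReal

/-- Càdlàg functions `[0,1] → S`: right-continuous at every point (this says nothing at `t = 1`),
with a left limit in `S` at every `t ∈ (0,1]`. -/
structure Cadlag (S : Type*) [TopologicalSpace S] where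
  toFun : I → S
  rightCont : ∀ t : I, ContinuousWithinAt toFun (Ici t) t
  leftLim : ∀ t : I, 0 < t → ∃ l : S, Tendsto toFun (𝓝[<] t) (𝓝 l)

namespace Cadlag

instance instFunLike {S : Type*} [TopologicalSpace S] : FunLike (Cadlag S) I S where
  coe := Cadlag.toFun
  coe_injective x y h := by
    cases x; cases y; cases h; rfl

end Cadlag

/-- The set `Λ` of strictly increasing continuous functions from `[0,1]` onto `[0,1]`.
A strictly increasing surjection of `[0,1]` is an order isomorphism and conversely, and it is then
automatically continuous. -/
abbrev TimeChange : Type := I ≃o I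

namespace TimeChange

/-- `‖γ - e‖ = sup_t |γ(t) - t|`. -/
noncomputable def supCost (γ : TimeChange) : ℝ≥0∞ :=
  ⨆ t : I, ENNReal.ofReal |(γ t : ℝ) - (t : ℝ)|

/-- `‖γ‖⁰ = sup_{s < s'} |log ((γ(s') - γ(s)) / (s' - s))|`, possibly infinite. -/
noncomputable def logCost (γ : TimeChange) : ℝ≥0∞ :=
  ⨆ (s : I) (s' : I) (_ : s < s'),
    ENNReal.ofReal |Real.log (((γ s' : ℝ) - (γ s : ℝ)) / ((s' : ℝ) - (s : ℝ)))|

theorem supCost_refl : supCost (OrderIso.refl I) = 0 := by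
  simp [supCost]

theorem supCost_symm (γ : TimeChange) : supCost γ.symm ≤ supCost γ := by
  refine iSup_le fun t => ?_
  have h := le_iSup (fun u : I => ENNReal.ofReal |(γ u : ℝ) - (u : ℝ)|) (γ.symm t)
  simp only [OrderIso.apply_symm_apply] at h
  rw [abs_sub_comm]
  exact h

theorem supCost_trans (γ η : TimeChange) : supCost (γ.trans η) ≤ supCost γ + supCost η := by
  refine iSup_le fun t => ?_
  have h1 := le_iSup (fun u : I => ENNReal.ofReal |(γ u : ℝ) - (u : ℝ)|) t
  have h2 := le_iSup (fun u : I => ENNReal.ofReal |(η u : ℝ) - (u : ℝ)|) (γ t)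
  refine le_trans ?_ (add_le_add h1 h2)
  rw [← ENNReal.ofReal_add (abs_nonneg _) (abs_nonneg _)]
  refine ENNReal.ofReal_le_ofReal ?_
  rw [add_comm]
  exact abs_sub_le _ _ _

theorem supCost_small (ε : ℝ) (hε : 0 < ε) : ∃ η : ℝ≥0∞, 0 < η ∧
    ∀ γ : TimeChange, supCost γ < η → ∀ t : I, |(γ t : ℝ) - (t : ℝ)| < ε := by
  refine ⟨ENNReal.ofReal ε, by simpa using hε, fun γ h t => ?_⟩
  have h1 := le_iSup (fun u : I => ENNReal.ofReal |(γ u : ℝ) - (u : ℝ)|) t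
  exact (ENNReal.ofReal_lt_ofReal_iff hε).1 (lt_of_le_of_lt h1 h)

theorem le_logCost (γ : TimeChange) {s s' : I} (h : s < s') :
    ENNReal.ofReal |Real.log (((γ s' : ℝ) - (γ s : ℝ)) / ((s' : ℝ) - (s : ℝ)))| ≤ logCost γ :=
  le_iSup_of_le s (le_iSup_of_le s' (le_iSup_of_le h le_rfl))

theorem logCost_refl : logCost (OrderIso.refl I) = 0 := by
  simp only [logCost, ENNReal.iSup_eq_zero]
  intro s s' h
  have h' : (0 : ℝ) < (s' : ℝ) - (s : ℝ) := sub_pos.2 h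
  simp [div_self h'.ne']

theorem logCost_symm (γ : TimeChange) : logCost γ.symm ≤ logCost γ := by
  refine iSup_le fun s => iSup_le fun s' => iSup_le fun h => ?_
  have h1 := le_logCost γ (γ.symm.strictMono h)
  simp only [OrderIso.apply_symm_apply] at h1
  rw [← inv_div, Real.log_inv, abs_neg] at h1
  exact h1

theorem logCost_trans (γ η : TimeChange) : logCost (γ.trans η) ≤ logCost γ + logCost η := by
  refine iSup_le fun s => iSup_le fun s' => iSup_le fun h => ?_
  refine le_trans ?_ (add_le_add (le_logCost γ h) (le_logCost η (γ.strictMono h)))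
  rw [← ENNReal.ofReal_add (abs_nonneg _) (abs_nonneg _)]
  refine ENNReal.ofReal_le_ofReal ?_
  have a : (0 : ℝ) < (s' : ℝ) - (s : ℝ) := sub_pos.2 h
  have b : (0 : ℝ) < (γ s' : ℝ) - (γ s : ℝ) := sub_pos.2 (γ.strictMono h)
  have c : (0 : ℝ) < (η (γ s') : ℝ) - (η (γ s) : ℝ) := sub_pos.2 (η.strictMono (γ.strictMono h))
  refine le_trans (le_of_eq ?_) (abs_add_le _ _)
  rw [← Real.log_mul (div_pos b a).ne' (div_pos c b).ne']
  congr 2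
  simp only [OrderIso.trans_apply]
  field_simp

theorem logCost_small (ε : ℝ) (hε : 0 < ε) : ∃ η : ℝ≥0∞, 0 < η ∧
    ∀ γ : TimeChange, logCost γ < η → ∀ t : I, |(γ t : ℝ) - (t : ℝ)| < ε := by
  have hL : 0 < Real.log (1 + ε) := Real.log_pos (by linarith)
  refine ⟨ENNReal.ofReal (Real.log (1 + ε)), by simpa using hL, fun γ h t => ?_⟩
  rcases eq_or_lt_of_le (show (0 : I) ≤ t from t.2.1) with rfl | ht
  · have h0 : γ 0 = 0 := map_bot γ
    simpa [h0] using hε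
  · have h1 := (ENNReal.ofReal_lt_ofReal_iff hL).1 (lt_of_le_of_lt (le_logCost γ ht) h)
    have h0 : γ 0 = 0 := map_bot γ
    have htp : (0 : ℝ) < (t : ℝ) := ht
    have hγ : (0 : ℝ) < (γ t : ℝ) := by
      have : γ 0 < γ t := γ.strictMono ht
      rw [h0] at this
      exact this
    have ht1 : (t : ℝ) ≤ 1 := t.2.2
    rw [h0] at h1
    rw [show ((0 : I) : ℝ) = 0 from rfl, sub_zero, sub_zero] at h1
    rw [abs_lt] at h1
    have u : (γ t : ℝ) / t < 1 + ε := (Real.log_lt_log_iff (by positivity) (by linarith)).1 h1.2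
    have l : (1 + ε)⁻¹ < (γ t : ℝ) / t := by
      rw [← Real.log_inv] at h1
      exact (Real.log_lt_log_iff (by positivity) (by positivity)).1 h1.1
    rw [div_lt_iff₀ htp] at u
    rw [lt_div_iff₀ htp, inv_mul_lt_iff₀ (by linarith)] at l
    have hγ1 : (γ t : ℝ) ≤ 1 := (γ t).2.2
    rw [abs_lt]
    constructor <;> nlinarith

end TimeChange

namespace Cadlag

/-- `inf_γ { c(γ) ∨ sup_t dist(x(t), y(γ(t))) }`, the Skorohod-type distance in which time changes
are penalized by `c`, as an extended nonnegative real. -/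
noncomputable def skorohodEDist {S : Type*} [PseudoEMetricSpace S] (c : TimeChange → ℝ≥0∞)
    (x y : Cadlag S) : ℝ≥0∞ :=
  ⨅ γ : TimeChange, max (c γ) (⨆ t : I, edist (x t) (y (γ t)))

theorem skorohodEDist_self {S : Type*} [PseudoEMetricSpace S] {c : TimeChange → ℝ≥0∞}
    (h0 : c (OrderIso.refl I) = 0) (x : Cadlag S) : skorohodEDist c x x = 0 := by
  refine le_antisymm (iInf_le_of_le (OrderIso.refl I) ?_) bot_le
  simp [h0]

theorem skorohodEDist_comm_le {S : Type*} [PseudoEMetricSpace S] {c : TimeChange → ℝ≥0∞}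
    (hs : ∀ γ, c γ.symm ≤ c γ) (x y : Cadlag S) :
    skorohodEDist c x y ≤ skorohodEDist c y x := by
  refine le_iInf fun γ => iInf_le_of_le γ.symm (max_le_max (hs γ) (iSup_le fun t => ?_))
  have h := le_iSup (fun u : I => edist (y u) (x (γ u))) (γ.symm t)
  simp only [OrderIso.apply_symm_apply] at h
  rw [edist_comm]
  exact h

theorem skorohodEDist_triangle {S : Type*} [PseudoEMetricSpace S] {c : TimeChange → ℝ≥0∞}
    (ht : ∀ γ η : TimeChange, c (γ.trans η) ≤ c γ + c η) (x y z : Cadlag S) :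
    skorohodEDist c x z ≤ skorohodEDist c x y + skorohodEDist c y z := by
  refine ENNReal.le_iInf_add_iInf fun γ η => iInf_le_of_le (γ.trans η) (max_le ?_ ?_)
  · exact (ht γ η).trans (add_le_add (le_max_left _ _) (le_max_left _ _))
  · refine iSup_le fun t => (edist_triangle _ (y (γ t)) _).trans (add_le_add ?_ ?_)
    · exact (le_iSup (fun u : I => edist (x u) (y (γ u))) t).trans (le_max_right _ _)
    · exact (le_iSup (fun u : I => edist (y u) (z (η u))) (γ t)).trans (le_max_right _ _)

theorem eq_of_skorohodEDist_eq_zero {S : Type*} [EMetricSpace S] {c : TimeChange → ℝ≥0∞}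
    (hc : ∀ ε : ℝ, 0 < ε → ∃ η : ℝ≥0∞, 0 < η ∧
      ∀ γ : TimeChange, c γ < η → ∀ t : I, |(γ t : ℝ) - (t : ℝ)| < ε)
    {x y : Cadlag S} (h : skorohodEDist c x y = 0) : x = y := by
  have key : ∀ η : ℝ≥0∞, 0 < η → ∃ γ : TimeChange, c γ < η ∧ ∀ t, edist (x t) (y (γ t)) < η := by
    intro η hη
    have h' : skorohodEDist c x y < η := by rw [h]; exact hη
    obtain ⟨γ, hγ⟩ := iInf_lt_iff.1 h'
    rw [max_lt_iff] at hγ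
    exact ⟨γ, hγ.1, fun t => lt_of_le_of_lt (le_iSup (fun u => edist (x u) (y (γ u))) t) hγ.2⟩
  refine DFunLike.ext _ _ fun t => ?_
  refine edist_le_zero.1 (ENNReal.le_of_forall_pos_le_add fun ε hε _ => ?_)
  rw [zero_add]
  rcases eq_or_lt_of_le (show t ≤ (1 : I) from t.2.2) with rfl | ht
  · obtain ⟨γ, -, hγ⟩ := key ε (by simpa using hε)
    have h1 := hγ 1
    rw [show γ 1 = 1 from map_top γ] at h1
    exact h1.le
  · have hε3 : (0 : ℝ≥0∞) < ε / 3 := ENNReal.div_pos (by simpa using hε.ne') (by simp)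
    have hx := EMetric.tendsto_nhds.1 (x.rightCont t) _ hε3
    have hy := EMetric.tendsto_nhds.1 (y.rightCont t) _ hε3
    obtain ⟨δ, hδ, hball⟩ := Metric.mem_nhdsWithin_iff.1 (hx.and hy)
    set r : ℝ := min δ (1 - t) with hr
    have ht' : (t : ℝ) < 1 := ht
    have hrpos : 0 < r := lt_min hδ (by linarith)
    have hr1 : r ≤ 1 - t := min_le_right _ _
    have hrδ : r ≤ δ := min_le_left _ _
    have ht0 : (0 : ℝ) ≤ t := t.2.1
    obtain ⟨η, hη, hsmall⟩ := hc (r / 2) (by linarith)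
    obtain ⟨γ, hγc, hγ⟩ := key (min η (ε / 3)) (lt_min hη hε3)
    let s : I := ⟨t + r / 2, by linarith, by linarith⟩
    have hs : (s : ℝ) = t + r / 2 := rfl
    have hclose := abs_lt.1 (hsmall γ (lt_of_lt_of_le hγc (min_le_left _ _)) s)
    have mem : ∀ u : I, (t : ℝ) ≤ u → (u : ℝ) < t + r →
        edist (x u) (x t) < ε / 3 ∧ edist (y u) (y t) < ε / 3 := by
      intro u h1 h2
      refine hball ⟨?_, h1⟩
      rw [Metric.mem_ball, Subtype.dist_eq, Real.dist_eq, abs_lt]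
      constructor <;> linarith
    have hxs := (mem s (by linarith) (by linarith)).1
    have hys := (mem (γ s) (by linarith [hclose.1]) (by linarith [hclose.2])).2
    rw [edist_comm] at hxs
    have hxy := lt_of_lt_of_le (hγ s) (min_le_right _ _)
    calc edist (x t) (y t) ≤ edist (x t) (x s) + edist (x s) (y (γ s)) + edist (y (γ s)) (y t) :=
          edist_triangle4 _ _ _ _
      _ ≤ ε / 3 + ε / 3 + ε / 3 := by gcongr
      _ = ε := ENNReal.add_thirds _

/-- The Skorohod metric `inf_γ { ‖γ‖⁰ ∨ sup_t dist(x(t), y(γ(t))) }`. -/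
noncomputable abbrev logSkorohodMetric (S : Type*) [EMetricSpace S] : EMetricSpace (Cadlag S) where
  edist := skorohodEDist TimeChange.logCost
  edist_self := skorohodEDist_self TimeChange.logCost_refl
  edist_comm x y := le_antisymm (skorohodEDist_comm_le TimeChange.logCost_symm x y)
    (skorohodEDist_comm_le TimeChange.logCost_symm y x)
  edist_triangle := skorohodEDist_triangle TimeChange.logCost_trans
  eq_of_edist_eq_zero := eq_of_skorohodEDist_eq_zero TimeChange.logCost_small

/-- The Skorohod metric `inf_γ { ‖γ - e‖ ∨ sup_t dist(x(t), y(γ(t))) }`. -/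
noncomputable abbrev supSkorohodMetric (S : Type*) [EMetricSpace S] : EMetricSpace (Cadlag S) where
  edist := skorohodEDist TimeChange.supCost
  edist_self := skorohodEDist_self TimeChange.supCost_refl
  edist_comm x y := le_antisymm (skorohodEDist_comm_le TimeChange.supCost_symm x y)
    (skorohodEDist_comm_le TimeChange.supCost_symm y x)
  edist_triangle := skorohodEDist_triangle TimeChange.supCost_trans
  eq_of_edist_eq_zero := eq_of_skorohodEDist_eq_zero TimeChange.supCost_small

end Cadlag

/-- The Skorohod space `D` of real càdlàg functions on `[0,1]`. -/
abbrev SkorohodD : Type := Cadlag ℝ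

/-- `D` carries the complete metric `d⁰_{J₁}`, which induces the `J₁` topology. -/
noncomputable instance SkorohodD.instEMetricSpace : EMetricSpace SkorohodD :=
  Cadlag.logSkorohodMetric ℝ

/-- The space `D([0,1]; D)` of functions `[0,1] → D` that are càdlàg for the `J₁` topology. -/
abbrev SkorohodDD : Type := Cadlag SkorohodD

/-- `D([0,1]; D)` carries the metric `d_D(x,y) = inf_γ { ‖γ - e‖ ∨ sup_t d⁰_{J₁}(x(t), y(γ(t))) }`. -/
noncomputable instance SkorohodDD.instEMetricSpace : EMetricSpace SkorohodDD :=
  Cadlag.supSkorohodMetric SkorohodD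

/-- The Borel σ-field of `(D([0,1]; D), d_D)`. -/
noncomputable instance SkorohodDD.instMeasurableSpace : MeasurableSpace SkorohodDD :=
  borel SkorohodDD

instance SkorohodDD.instBorelSpace : BorelSpace SkorohodDD := ⟨rfl⟩

/-- The super-uniform norm `sup_t sup_s |x(t,s)|`. -/
noncomputable def SkorohodDD.superNorm (x : SkorohodDD) : ℝ≥0∞ :=
  ⨆ (t : I) (s : I), ENNReal.ofReal |x t s|

/-- A `δ`-sparse set `0 = t₀ < t₁ < ⋯ < t_v = 1`, i.e. `t_i - t_{i-1} > δ` for all `i`. -/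
structure SparsePartition (δ : ℝ) where
  v : ℕ
  pt : Fin (v + 1) → I
  first : pt 0 = 0
  last : pt (Fin.last v) = 1
  strictMono : StrictMono pt
  sparse : ∀ i : Fin v, δ < (pt i.succ : ℝ) - (pt i.castSucc : ℝ)

namespace Cadlag

/-- The oscillation `w(x,T) = sup_{t₁, t₂ ∈ T} dist(x(t₁), x(t₂))`. -/
noncomputable def osc {S : Type*} [PseudoEMetricSpace S] (x : Cadlag S) (T : Set I) : ℝ≥0∞ :=
  ⨆ (t₁ ∈ T) (t₂ ∈ T), edist (x t₁) (x t₂)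

/-- The modulus `inf_{t_i} max_i w(x, [t_{i-1}, t_i))` over all `δ`-sparse sets. It is `w'(x,δ)` for
`S = ℝ` and `w'_D(x,δ)` for `S = D` with the metric `d⁰_{J₁}`. -/
noncomputable def modulus {S : Type*} [PseudoEMetricSpace S] (x : Cadlag S) (δ : ℝ) : ℝ≥0∞ :=
  ⨅ p : SparsePartition δ, ⨆ i : Fin p.v, x.osc (Ico (p.pt i.castSucc) (p.pt i.succ))

end Cadlag

namespace TimeChange

theorem bounds_of_logCost_le {γ : TimeChange} {η : ℝ} (hη : 0 ≤ η)
    (h : logCost γ ≤ ENNReal.ofReal η) {s s' : I} (hs : s < s') :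
    Real.exp (-η) * ((s' : ℝ) - s) ≤ (γ s' : ℝ) - γ s ∧
      (γ s' : ℝ) - γ s ≤ Real.exp η * ((s' : ℝ) - s) := by
  have h1 := (ENNReal.ofReal_le_ofReal_iff hη).1 ((le_logCost γ hs).trans h)
  have a : (0 : ℝ) < (s' : ℝ) - (s : ℝ) := sub_pos.2 hs
  have b : (0 : ℝ) < (γ s' : ℝ) - (γ s : ℝ) := sub_pos.2 (γ.strictMono hs)
  rw [abs_le, Real.le_log_iff_exp_le (div_pos b a), Real.log_le_iff_le_exp (div_pos b a),
    le_div_iff₀ a, div_le_iff₀ a] at h1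
  exact h1

/-- A function with difference quotients in `[e^{-η}, e^η]` fixing the end points is a time change
of logarithmic cost at most `η`. -/
theorem exists_eq_of_bounds {f : I → ℝ} {η : ℝ} (h0 : f 0 = 0) (h1 : f 1 = 1)
    (h : ∀ s s' : I, s < s' → Real.exp (-η) * ((s' : ℝ) - s) ≤ f s' - f s ∧
      f s' - f s ≤ Real.exp η * ((s' : ℝ) - s)) :
    ∃ γ : TimeChange, (∀ t, (γ t : ℝ) = f t) ∧ logCost γ ≤ ENNReal.ofReal η := by
  have hpos : ∀ s s' : I, s < s' → 0 < Real.exp (-η) * ((s' : ℝ) - s) := fun s s' hs =>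
    mul_pos (Real.exp_pos _) (sub_pos.2 hs)
  have hmono : StrictMono f := fun s s' hs => sub_pos.1 ((hpos s s' hs).trans_le (h s s' hs).1)
  have hlip : LipschitzWith (Real.exp η).toNNReal f := by
    refine LipschitzWith.of_le_add_mul _ fun x y => ?_
    rw [Real.coe_toNNReal _ (Real.exp_pos _).le]
    rcases lt_or_ge y x with hxy | hxy
    · have h2 := (h y x hxy).2
      have hxy' : (y : ℝ) < x := hxy
      have h3 : dist x y = (x : ℝ) - y := by
        rw [Subtype.dist_eq, Real.dist_eq, abs_of_pos (sub_pos.2 hxy')]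
      rw [h3]
      linarith
    · have := hmono.monotone hxy
      have h4 : 0 ≤ Real.exp η * dist x y := by positivity
      linarith
  have hmem : ∀ t, f t ∈ I := fun t =>
    ⟨h0 ▸ hmono.monotone t.2.1, h1 ▸ hmono.monotone t.2.2⟩
  let g : I → I := fun t => ⟨f t, hmem t⟩
  have hg : StrictMono g := fun s s' hs => hmono hs
  have hsurj : Function.Surjective g := fun c => by
    obtain ⟨t, ht⟩ := mem_range_of_exists_le_of_exists_ge (c := (c : ℝ)) hlip.continuous
      ⟨0, h0 ▸ c.2.1⟩ ⟨1, h1 ▸ c.2.2⟩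
    exact ⟨t, Subtype.ext ht⟩
  refine ⟨hg.orderIsoOfSurjective g hsurj, fun t => rfl, ?_⟩
  refine iSup_le fun s => iSup_le fun s' => iSup_le fun hs => ENNReal.ofReal_le_ofReal ?_
  have a : (0 : ℝ) < (s' : ℝ) - (s : ℝ) := sub_pos.2 hs
  have b : 0 < f s' - f s := sub_pos.2 (hmono hs)
  change |Real.log ((f s' - f s) / ((s' : ℝ) - s))| ≤ η
  rw [abs_le, Real.le_log_iff_exp_le (div_pos b a), Real.log_le_iff_le_exp (div_pos b a),
    le_div_iff₀ a, div_le_iff₀ a]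
  exact h s s' hs

theorem exists_eq_of_tendsto {ν : ℕ → TimeChange} {g : I → I} {η : ℝ} (hη : 0 ≤ η)
    (hν : ∀ n, logCost (ν n) ≤ ENNReal.ofReal η)
    (hg : ∀ t, Tendsto (fun n => ν n t) atTop (𝓝 (g t))) :
    ∃ γ : TimeChange, (∀ t, γ t = g t) ∧ logCost γ ≤ ENNReal.ofReal η := by
  have hg' : ∀ t, Tendsto (fun n => (ν n t : ℝ)) atTop (𝓝 (g t : ℝ)) := fun t =>
    (continuous_subtype_val.tendsto _).comp (hg t)
  have h0 : g 0 = 0 := tendsto_nhds_unique (hg 0) (by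
    simp only [show ∀ n, ν n 0 = 0 from fun n => map_bot (ν n)]; exact tendsto_const_nhds)
  have h1 : g 1 = 1 := tendsto_nhds_unique (hg 1) (by
    simp only [show ∀ n, ν n 1 = 1 from fun n => map_top (ν n)]; exact tendsto_const_nhds)
  obtain ⟨γ, hγ, hc⟩ := exists_eq_of_bounds (f := fun t => (g t : ℝ)) (η := η) (by simp [h0])
    (by simp [h1]) fun s s' hs =>
      ⟨ge_of_tendsto' ((hg' s').sub (hg' s)) fun n => (bounds_of_logCost_le hη (hν n) hs).1,
        le_of_tendsto' ((hg' s').sub (hg' s)) fun n => (bounds_of_logCost_le hη (hν n) hs).2⟩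
  exact ⟨γ, fun t => Subtype.ext (hγ t), hc⟩

theorem edist_apply_le {γ : TimeChange} {η : ℝ} (hη : 0 ≤ η) (hη1 : η ≤ 1)
    (h : logCost γ ≤ ENNReal.ofReal η) (t : I) : edist t (γ t) ≤ ENNReal.ofReal (2 * η) := by
  rw [edist_dist]
  refine ENNReal.ofReal_le_ofReal ?_
  rw [Subtype.dist_eq, Real.dist_eq, abs_le]
  rcases eq_or_lt_of_le (show (0 : I) ≤ t from t.2.1) with rfl | ht
  · rw [show γ 0 = 0 from map_bot γ]
    constructor <;> linarith
  · have hb := bounds_of_logCost_le hη h ht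
    rw [show γ 0 = 0 from map_bot γ, show ((0 : I) : ℝ) = 0 from rfl, sub_zero, sub_zero] at hb
    have e1 := (abs_le.1 (Real.abs_exp_sub_one_le (x := η) (by rwa [abs_of_nonneg hη]))).2
    rw [abs_of_nonneg hη] at e1
    have e2 := Real.add_one_le_exp (-η)
    have ht0 := t.2.1
    have ht1 := t.2.2
    constructor <;> nlinarith

end TimeChange

namespace Cadlag

variable {S : Type*}

/-- The composition of a càdlàg function with a time change. -/
def comp [TopologicalSpace S] (x : Cadlag S) (γ : TimeChange) : Cadlag S where
  toFun t := x (γ t)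
  rightCont t := (x.rightCont (γ t)).comp γ.continuous.continuousWithinAt
    fun _ hs => γ.monotone hs
  leftLim t ht := by
    have h0 : γ 0 = 0 := map_bot γ
    obtain ⟨l, hl⟩ := x.leftLim (γ t) (h0 ▸ γ.strictMono ht)
    exact ⟨l, hl.comp (tendsto_nhdsWithin_of_tendsto_nhds_of_eventually_within _
      (γ.continuous.continuousWithinAt) (eventually_mem_nhdsWithin.mono fun _ hs =>
        γ.strictMono hs))⟩

theorem comp_apply [TopologicalSpace S] (x : Cadlag S) (γ : TimeChange) (t : I) :
    x.comp γ t = x (γ t) := rfl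

/-- A uniform limit of càdlàg functions is càdlàg. -/
theorem exists_eq_of_uniform [PseudoEMetricSpace S] [CompleteSpace S] {y : I → S}
    (h : ∀ ε : ℝ≥0∞, 0 < ε → ∃ x : Cadlag S, ∀ t, edist (x t) (y t) < ε) :
    ∃ z : Cadlag S, ∀ t, z t = y t := by
  refine ⟨⟨y, fun t => ?_, fun t ht => ?_⟩, fun t => rfl⟩
  · refine EMetric.tendsto_nhds.2 fun ε hε => ?_
    have hε3 : 0 < ε / 3 := ENNReal.div_pos hε.ne' (by simp)
    obtain ⟨x, hx⟩ := h _ hε3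
    filter_upwards [EMetric.tendsto_nhds.1 (x.rightCont t) _ hε3] with s hs
    calc edist (y s) (y t) ≤ edist (y s) (x s) + edist (x s) (x t) + edist (x t) (y t) :=
          edist_triangle4 _ _ _ _
      _ < ε / 3 + ε / 3 + ε / 3 := by
          rw [edist_comm (y s)]
          exact ENNReal.add_lt_add (ENNReal.add_lt_add (hx s) hs) (hx t)
      _ = ε := ENNReal.add_thirds _
  · have : (𝓝[<] t).NeBot := nhdsLT_neBot_of_exists_lt ⟨0, ht⟩
    refine CompleteSpace.complete (EMetric.cauchy_iff.2 ⟨(map_neBot).ne, fun ε hε => ?_⟩)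
    have hε3 : 0 < ε / 3 := ENNReal.div_pos hε.ne' (by simp)
    have hε32 : 0 < ε / 3 / 2 := ENNReal.div_pos hε3.ne' (by simp)
    obtain ⟨x, hx⟩ := h _ hε3
    obtain ⟨l, hl⟩ := x.leftLim t ht
    refine ⟨y '' {s | edist (x s) l < ε / 3 / 2}, image_mem_map (EMetric.tendsto_nhds.1 hl _ hε32),
      ?_⟩
    rintro _ ⟨s, hs, rfl⟩ _ ⟨s', hs', rfl⟩
    have h1 : edist (x s) (x s') < ε / 3 := by
      rw [← ENNReal.add_halves (ε / 3)]
      exact (edist_triangle_right _ _ l).trans_lt (ENNReal.add_lt_add hs hs')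
    calc edist (y s) (y s') ≤ edist (y s) (x s) + edist (x s) (x s') + edist (x s') (y s') :=
          edist_triangle4 _ _ _ _
      _ < ε / 3 + ε / 3 + ε / 3 := by
          rw [edist_comm (y s)]
          exact ENNReal.add_lt_add (ENNReal.add_lt_add (hx s) h1) (hx s')
      _ = ε := ENNReal.add_thirds _

theorem exists_of_skorohodEDist_lt [PseudoEMetricSpace S] {c : TimeChange → ℝ≥0∞} {x y : Cadlag S}
    {r : ℝ≥0∞} (h : skorohodEDist c x y < r) :
    ∃ γ : TimeChange, c γ < r ∧ ∀ t, edist (x t) (y (γ t)) < r := by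
  obtain ⟨γ, hγ⟩ := iInf_lt_iff.1 h
  rw [max_lt_iff] at hγ
  exact ⟨γ, hγ.1, fun t => (le_iSup (fun u => edist (x u) (y (γ u))) t).trans_lt hγ.2⟩

theorem skorohodEDist_le [PseudoEMetricSpace S] {c : TimeChange → ℝ≥0∞} {x y : Cadlag S}
    {r : ℝ≥0∞} (γ : TimeChange) (h : c γ ≤ r) (h' : ∀ t, edist (x t) (y (γ t)) ≤ r) :
    skorohodEDist c x y ≤ r :=
  iInf_le_of_le γ (max_le h (iSup_le h'))

/-- `1 / 2 ^ n` in the two forms used for geometric estimates. -/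
theorem one_div_two_pow_eq_ofReal (n : ℕ) :
    (1 / 2 ^ n : ℝ≥0∞) = ENNReal.ofReal ((1 / 2) ^ n) := by
  rw [one_div_pow, ENNReal.ofReal_div_of_pos (by positivity), ENNReal.ofReal_one,
    ENNReal.ofReal_pow (by norm_num), ENNReal.ofReal_ofNat]

theorem tendsto_two_mul_one_div_two_pow :
    Tendsto (fun n : ℕ => (2 * 1 / 2 ^ n : ℝ≥0∞)) atTop (𝓝 0) := by
  have h (n : ℕ) : (2 * 1 / 2 ^ n : ℝ≥0∞) = ENNReal.ofReal (2 * (1 / 2) ^ n) := by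
    rw [ENNReal.ofReal_mul (by norm_num), ← one_div_two_pow_eq_ofReal, ENNReal.ofReal_ofNat,
      mul_div_assoc]
  simp only [h]
  simpa using ENNReal.tendsto_ofReal
    ((tendsto_pow_atTop_nhds_zero_of_lt_one (r := (1 / 2 : ℝ)) (by norm_num)
      (by norm_num)).const_mul 2)

/-- If consecutive terms are geometrically close then the Skorohod sequence converges. -/
theorem exists_limit_of_geometric [EMetricSpace S] [CompleteSpace S] {u : ℕ → Cadlag S}
    (hu : ∀ n, skorohodEDist TimeChange.logCost (u n) (u (n + 1)) < 1 / 2 ^ n) :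
    ∃ x : Cadlag S, ∀ n, skorohodEDist TimeChange.logCost (u n) x ≤ 2 * 1 / 2 ^ n := by
  choose γ hγc hγ using fun n => exists_of_skorohodEDist_lt (hu n)
  let ν : ℕ → TimeChange := fun n => Nat.rec (OrderIso.refl I) (fun k μ => μ.trans (γ k)) n
  have hνs : ∀ n t, ν (n + 1) t = γ n (ν n t) := fun n t => rfl
  -- the time changes converge
  have hcost : ∀ n m, TimeChange.logCost ((ν n).symm.trans (ν (n + m))) ≤
      ENNReal.ofReal (2 * (1 / 2) ^ n - 2 * (1 / 2) ^ (n + m)) := by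
    intro n m
    induction m with
    | zero =>
      rw [add_zero, sub_self, OrderIso.symm_trans_self, TimeChange.logCost_refl]
      exact bot_le
    | succ m ih =>
      have h1 : (ν n).symm.trans (ν (n + (m + 1))) =
          ((ν n).symm.trans (ν (n + m))).trans (γ (n + m)) := rfl
      rw [h1]
      refine (TimeChange.logCost_trans _ _).trans ?_
      refine (add_le_add ih ((hγc (n + m)).le.trans_eq (one_div_two_pow_eq_ofReal _))).trans_eq ?_
      have h2 : (1 / 2 : ℝ) ^ (n + m) ≤ (1 / 2) ^ n :=
        pow_le_pow_of_le_one (by norm_num) (by norm_num) (by omega)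
      rw [← ENNReal.ofReal_add (by linarith) (by positivity)]
      congr 1
      rw [← add_assoc, pow_succ _ (n + m)]
      ring
  have hcauchy : ∀ t, CauchySeq fun n => ν n t := fun t => by
    refine cauchySeq_of_edist_le_geometric_two 2 (by simp) fun n => ?_
    rw [hνs]
    refine (TimeChange.edist_apply_le (by positivity) (pow_le_one₀ (by norm_num) (by norm_num))
      ((hγc n).le.trans_eq (one_div_two_pow_eq_ofReal n)) _).trans_eq ?_
    rw [ENNReal.ofReal_mul (by norm_num), ← one_div_two_pow_eq_ofReal, ENNReal.ofReal_ofNat,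
      mul_one_div]
  choose g hg using fun t => cauchySeq_tendsto_of_complete (hcauchy t)
  have hcost' : ∀ n m, TimeChange.logCost ((ν n).symm.trans (ν (m + n))) ≤
      ENNReal.ofReal (2 * (1 / 2) ^ n) := fun n m => by
    rw [add_comm]
    refine (hcost n m).trans (ENNReal.ofReal_le_ofReal ?_)
    have : (0 : ℝ) ≤ 2 * (1 / 2) ^ (n + m) := by positivity
    linarith
  have hlim : ∀ n, ∃ κ : TimeChange, (∀ t, κ t = g ((ν n).symm t)) ∧
      TimeChange.logCost κ ≤ ENNReal.ofReal (2 * (1 / 2) ^ n) := fun n =>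
    TimeChange.exists_eq_of_tendsto (by positivity) (hcost' n) fun t =>
      (tendsto_add_atTop_iff_nat n).2 (hg ((ν n).symm t))
  choose κ hκ hκc using hlim
  -- the time-changed functions converge uniformly
  have hstep : ∀ t n, edist (u n (ν n t)) (u (n + 1) (ν (n + 1) t)) ≤ 1 / 2 ^ n := fun t n =>
    (hγ n (ν n t)).le
  choose y hy using fun t => cauchySeq_tendsto_of_complete
    (cauchySeq_of_edist_le_geometric_two 1 (by simp) (hstep t))
  have hyu : ∀ n t, edist (u n (ν n t)) (y t) ≤ 2 * 1 / 2 ^ n := fun n t =>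
    edist_le_of_edist_le_geometric_two_of_tendsto 1 (hstep t) (hy t) n
  obtain ⟨z, hz⟩ := exists_eq_of_uniform (y := y) fun ε hε => by
    obtain ⟨n, hn⟩ := (tendsto_two_mul_one_div_two_pow.eventually_lt_const hε).exists
    exact ⟨(u n).comp (ν n), fun t => (hyu n t).trans_lt hn⟩
  have hκ0 : ∀ t, κ 0 t = g t := hκ 0
  refine ⟨z.comp (κ 0).symm, fun n => skorohodEDist_le (κ n) ?_ fun t => ?_⟩
  · refine (hκc n).trans_eq ?_
    rw [ENNReal.ofReal_mul (by norm_num), ← one_div_two_pow_eq_ofReal, ENNReal.ofReal_ofNat,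
      mul_one_div, mul_one]
  · rw [comp_apply, hκ, ← hκ0, OrderIso.symm_apply_apply, hz]
    simpa using hyu n ((ν n).symm t)

theorem completeSpace_logSkorohod [EMetricSpace S] [CompleteSpace S] :
    @CompleteSpace (Cadlag S) (logSkorohodMetric S).toUniformSpace := by
  let _ := logSkorohodMetric S
  refine EMetric.complete_of_convergent_controlled_sequences (fun n => 1 / 2 ^ n)
    (fun n => ENNReal.div_pos (by simp) (by simp)) fun u hu => ?_
  obtain ⟨x, hx⟩ := exists_limit_of_geometric fun n => hu n n (n + 1) le_rfl (Nat.le_succ n)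
  refine ⟨x, tendsto_iff_edist_tendsto_0.2 (tendsto_of_tendsto_of_tendsto_of_le_of_le
    tendsto_const_nhds tendsto_two_mul_one_div_two_pow (fun _ => bot_le) hx)⟩

end Cadlag

namespace SparsePartition

variable {δ : ℝ}

/-- A sparse set is sparse for smaller parameters. -/
def weaken (p : SparsePartition δ) {δ' : ℝ} (h : δ' ≤ δ) : SparsePartition δ' :=
  { p with sparse := fun i => h.trans_lt (p.sparse i) }

/-- The image of a sparse set under a time change close to the identity. -/
def map (p : SparsePartition δ) (γ : TimeChange) {r : ℝ}
    (h : ∀ t, |(γ t : ℝ) - t| ≤ r) : SparsePartition (δ - 2 * r) where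
  v := p.v
  pt i := γ (p.pt i)
  first := by rw [p.first]; exact map_bot γ
  last := by rw [p.last]; exact map_top γ
  strictMono := γ.strictMono.comp p.strictMono
  sparse i := by
    have h1 := abs_le.1 (h (p.pt i.succ))
    have h2 := abs_le.1 (h (p.pt i.castSucc))
    linarith [p.sparse i]

theorem exists_mem_Ico (p : SparsePartition δ) {u : I} (hu : u < 1) :
    ∃ i : Fin p.v, u ∈ Ico (p.pt i.castSucc) (p.pt i.succ) := by
  obtain ⟨j, hj, hmax⟩ := (Finset.univ.filter fun j => p.pt j ≤ u).exists_max_image id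
    ⟨0, by simp [p.first]⟩
  simp only [Finset.mem_filter, Finset.mem_univ, true_and, id] at hj hmax
  have hne : j ≠ Fin.last p.v := by
    rintro rfl
    rw [p.last] at hj
    exact absurd hu hj.not_gt
  obtain ⟨i, rfl⟩ := Fin.exists_castSucc_eq.2 hne
  refine ⟨i, hj, lt_of_not_ge fun h => ?_⟩
  exact absurd (hmax _ h) (Fin.castSucc_lt_succ (i := i)).not_ge

theorem lt_sub_of_lt (p : SparsePartition δ) {i j : Fin (p.v + 1)} (h : i < j) :
    δ < (p.pt j : ℝ) - p.pt i := by
  obtain ⟨k, rfl⟩ := Fin.exists_succ_eq.2 ((Fin.zero_le i).trans_lt h).ne'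
  have h1 : p.pt i ≤ p.pt k.castSucc := p.strictMono.monotone (Fin.le_castSucc_iff.2 h)
  have h2 : (p.pt i : ℝ) ≤ p.pt k.castSucc := h1
  linarith [p.sparse k]

theorem v_mul_le (p : SparsePartition δ) : p.v * δ ≤ 1 := by
  have h : ∀ i : Fin (p.v + 1), (i : ℕ) * δ ≤ p.pt i := by
    intro i
    induction i using Fin.induction with
    | zero => simpa using (p.pt 0).2.1
    | succ i ih =>
      have := p.sparse i
      simp only [Fin.val_castSucc, Fin.val_succ, Nat.cast_add, Nat.cast_one] at ih ⊢
      linarith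
  simpa [p.last] using h (Fin.last p.v)

theorem exists_of_finset (Q : Finset I) (h0 : 0 ∈ Q) (h1 : 1 ∈ Q) :
    ∃ δ : ℝ, 0 < δ ∧ ∃ p : SparsePartition δ, ∀ q ∈ Q, ∃ j, p.pt j = q := by
  obtain ⟨v, hv⟩ : ∃ v, Q.card = v + 1 :=
    Nat.exists_eq_add_one.2 (Finset.card_pos.2 ⟨0, h0⟩)
  let e := Q.orderEmbOfFin hv
  have hmem : ∀ q ∈ Q, ∃ j, e j = q := fun q hq => by
    have : q ∈ Set.range e := by rw [Finset.range_orderEmbOfFin]; exact hq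
    exact this
  have hgap : ∀ᶠ δ in 𝓝[>] (0 : ℝ), ∀ i : Fin v, δ < (e i.succ : ℝ) - e i.castSucc := by
    refine eventually_all.2 fun i => mem_nhdsWithin_of_mem_nhds (eventually_lt_nhds ?_)
    exact sub_pos.2 (e.strictMono Fin.castSucc_lt_succ)
  obtain ⟨δ, hδ, hδ0⟩ := (hgap.and self_mem_nhdsWithin).exists
  refine ⟨δ, hδ0, ⟨v, e, ?_, ?_, e.strictMono, hδ⟩, hmem⟩
  · obtain ⟨j, hj⟩ := hmem 0 h0
    exact le_antisymm (hj ▸ e.monotone (Fin.zero_le j)) (e 0).2.1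
  · obtain ⟨j, hj⟩ := hmem 1 h1
    exact le_antisymm (e (Fin.last v)).2.2 (hj ▸ e.monotone (Fin.le_last j))

/-- A sparse set can be moved into the grid of mesh `1/N` by a time change of small cost. -/
theorem exists_timeChange_grid (p : SparsePartition δ) (hδ : 0 < δ) {η : ℝ} {N : ℕ} (hN0 : 0 < N)
    (hN : (1 / δ + 1) / (N * δ) ≤ 1 - Real.exp (-η)) :
    ∃ γ : TimeChange, TimeChange.logCost γ ≤ ENNReal.ofReal η ∧
      ∀ i, ∃ k : ℕ, (γ (p.pt i) : ℝ) = k / N := by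
  have hNr : (0 : ℝ) < N := Nat.cast_pos.2 hN0
  let c : Fin (p.v + 1) → ℝ := fun i => (⌊(N : ℝ) * p.pt i⌋₊ : ℝ) / N - p.pt i
  let T : Fin (p.v + 1) → I → ℝ := fun i t => max 0 (1 - |(t : ℝ) - p.pt i| / δ)
  have hc : ∀ i, |c i| ≤ 1 / N := fun i => by
    have h1 := Nat.floor_le (mul_nonneg hNr.le (p.pt i).2.1)
    have h2 := Nat.lt_floor_add_one ((N : ℝ) * p.pt i)
    have h3 : c i = ((⌊(N : ℝ) * p.pt i⌋₊ : ℝ) - N * p.pt i) / N := by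
      simp only [c]; field_simp
    rw [h3, abs_div, abs_of_pos hNr]
    refine div_le_div_of_nonneg_right ?_ hNr.le
    rw [abs_le]; constructor <;> linarith
  have hTlip : ∀ i (s s' : I), s < s' → |T i s' - T i s| ≤ ((s' : ℝ) - s) / δ := by
    intro i s s' hs
    have hs' : (0 : ℝ) < (s' : ℝ) - s := sub_pos.2 hs
    have h1 : |T i s' - T i s| ≤ |(1 - |(s' : ℝ) - p.pt i| / δ) - (1 - |(s : ℝ) - p.pt i| / δ)| := by
      simp only [T, max_comm (0 : ℝ)]
      exact abs_max_sub_max_le_abs _ _ _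
    refine h1.trans ?_
    rw [sub_sub_sub_cancel_left, ← sub_div, abs_div, abs_of_pos hδ]
    refine div_le_div_of_nonneg_right ((abs_abs_sub_abs_le_abs_sub _ _).trans_eq ?_) hδ.le
    rw [sub_sub_sub_cancel_right, abs_sub_comm, abs_of_pos hs']
  have hTself : ∀ i, T i (p.pt i) = 1 := fun i => by simp [T]
  have hTne : ∀ i j, i ≠ j → T i (p.pt j) = 0 := fun i j hij => by
    refine max_eq_left (sub_nonpos.2 ((one_le_div hδ).2 ?_))
    rcases lt_or_gt_of_ne hij with h | h
    · exact (p.lt_sub_of_lt h).le.trans (le_abs_self _)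
    · rw [abs_sub_comm]
      exact (p.lt_sub_of_lt h).le.trans (le_abs_self _)
  let f : I → ℝ := fun t => t + ∑ i, c i * T i t
  have hf : ∀ j, f (p.pt j) = (⌊(N : ℝ) * p.pt j⌋₊ : ℝ) / N := fun j => by
    have : ∑ i, c i * T i (p.pt j) = c j := by
      rw [Finset.sum_eq_single j (fun i _ hi => by rw [hTne i j hi, mul_zero]) (by simp),
        hTself, mul_one]
    simp only [f, this, c]
    ring
  have hg : ∀ s s' : I, s < s' → |∑ i, c i * T i s' - ∑ i, c i * T i s| ≤
      (1 - Real.exp (-η)) * ((s' : ℝ) - s) := by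
    intro s s' hs
    have hs' : (0 : ℝ) < (s' : ℝ) - s := sub_pos.2 hs
    rw [← Finset.sum_sub_distrib]
    calc |∑ i, (c i * T i s' - c i * T i s)| ≤ ∑ i, |c i * T i s' - c i * T i s| :=
          Finset.abs_sum_le_sum_abs _ _
      _ ≤ ∑ _i : Fin (p.v + 1), 1 / N * (((s' : ℝ) - s) / δ) := by
          refine Finset.sum_le_sum fun i _ => ?_
          rw [← mul_sub, abs_mul]
          exact mul_le_mul (hc i) (hTlip i s s' hs) (abs_nonneg _) (by positivity)
      _ = (p.v + 1) * (1 / N * (((s' : ℝ) - s) / δ)) := by simp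
      _ ≤ (1 / δ + 1) * (1 / N * (((s' : ℝ) - s) / δ)) := by
          have : (p.v : ℝ) ≤ 1 / δ := (le_div_iff₀ hδ).2 p.v_mul_le
          gcongr
      _ = (1 / δ + 1) / (N * δ) * ((s' : ℝ) - s) := by field_simp
      _ ≤ _ := by gcongr
  have hexp : 1 + (1 - Real.exp (-η)) ≤ Real.exp η := by
    have h1 := Real.add_one_le_exp (-η)
    have h2 := Real.add_one_le_exp η
    linarith
  obtain ⟨γ, hγ, hγc⟩ := TimeChange.exists_eq_of_bounds (f := f) (η := η)
    (by rw [← p.first, hf, p.first]; simp)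
    (by rw [← p.last, hf, p.last]; simp [hNr.ne'])
    (fun s s' hs => by
      have hs' : (0 : ℝ) < (s' : ℝ) - s := sub_pos.2 hs
      have h1 := abs_le.1 (hg s s' hs)
      have h2 := mul_le_mul_of_nonneg_right hexp hs'.le
      simp only [f]
      constructor <;> linarith)
  exact ⟨γ, hγc, fun i => ⟨_, (hγ _).trans (hf i)⟩⟩

end SparsePartition

namespace Cadlag

variable {S : Type*}

theorem modulus_mono [PseudoEMetricSpace S] (x : Cadlag S) : Monotone x.modulus := fun _ _ h =>
  le_iInf fun p => iInf_le_of_le (p.weaken h) le_rfl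

theorem modulus_le [PseudoEMetricSpace S] {x : Cadlag S} {δ : ℝ} {ε : ℝ≥0∞}
    (p : SparsePartition δ) (h : ∀ i : Fin p.v, ∀ u ∈ Ico (p.pt i.castSucc) (p.pt i.succ),
      ∀ w ∈ Ico (p.pt i.castSucc) (p.pt i.succ), edist (x u) (x w) ≤ ε) : x.modulus δ ≤ ε :=
  iInf_le_of_le p (iSup_le fun i => iSup₂_le fun u hu => iSup₂_le fun w hw => h i u hu w hw)

theorem exists_of_modulus_lt [PseudoEMetricSpace S] {x : Cadlag S} {δ : ℝ} {ε : ℝ≥0∞}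
    (h : x.modulus δ < ε) : ∃ p : SparsePartition δ, ∀ i : Fin p.v,
      ∀ u ∈ Ico (p.pt i.castSucc) (p.pt i.succ), ∀ w ∈ Ico (p.pt i.castSucc) (p.pt i.succ),
        edist (x u) (x w) < ε := by
  obtain ⟨p, hp⟩ := iInf_lt_iff.1 h
  refine ⟨p, fun i u hu w hw => lt_of_le_of_lt ?_ hp⟩
  exact le_iSup_of_le i (le_iSup₂_of_le u hu (le_iSup₂_of_le w hw le_rfl))

theorem exists_ball_edist_lt [PseudoEMetricSpace S] (x : Cadlag S) {ε : ℝ≥0∞} (hε : 0 < ε)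
    (t : I) : ∃ r > 0, ∀ u ∈ Metric.ball t r, ∀ w ∈ Metric.ball t r,
      (w < t ∨ t ≤ u) → u ≤ w → edist (x u) (x w) < ε := by
  have hε2 : 0 < ε / 2 := ENNReal.div_pos hε.ne' (by simp)
  obtain ⟨r₁, hr₁, h₁⟩ := Metric.mem_nhdsWithin_iff.1
    (EMetric.tendsto_nhds.1 (x.rightCont t) _ hε2)
  have hleft : ∃ r > 0, ∃ l, ∀ u ∈ Metric.ball t r, u < t → edist (x u) l < ε / 2 := by
    rcases eq_or_lt_of_le (show (0 : I) ≤ t from t.2.1) with rfl | ht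
    · exact ⟨1, one_pos, x 0, fun u _ hu => absurd hu (not_lt_of_ge u.2.1)⟩
    · obtain ⟨l, hl⟩ := x.leftLim t ht
      obtain ⟨r, hr, h⟩ := Metric.mem_nhdsWithin_iff.1 (EMetric.tendsto_nhds.1 hl _ hε2)
      exact ⟨r, hr, l, fun u hu hut => h ⟨hu, hut⟩⟩
  obtain ⟨r₂, hr₂, l, h₂⟩ := hleft
  refine ⟨min r₁ r₂, lt_min hr₁ hr₂, fun u hu w hw h huw => ?_⟩
  rw [← ENNReal.add_halves ε]
  rcases h with h | h
  · exact (edist_triangle_right _ _ l).trans_lt (ENNReal.add_lt_add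
      (h₂ u (Metric.ball_subset_ball (min_le_right _ _) hu) (huw.trans_lt h))
      (h₂ w (Metric.ball_subset_ball (min_le_right _ _) hw) h))
  · exact (edist_triangle_right _ _ (x t)).trans_lt (ENNReal.add_lt_add
      (h₁ ⟨Metric.ball_subset_ball (min_le_left _ _) hu, h⟩)
      (h₁ ⟨Metric.ball_subset_ball (min_le_left _ _) hw, h.trans huw⟩))

theorem exists_finset_edist_lt [PseudoEMetricSpace S] (x : Cadlag S) {ε : ℝ≥0∞} (hε : 0 < ε) :
    ∃ Q : Finset I, 0 ∈ Q ∧ 1 ∈ Q ∧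
      ∀ u w, u ≤ w → (∀ q ∈ Q, u < q → w < q) → edist (x u) (x w) < ε := by
  classical
  choose r hr hx using x.exists_ball_edist_lt hε
  obtain ⟨T, -, hT⟩ := isCompact_univ.elim_nhds_subcover (fun t => Metric.ball t (r t))
    fun t _ => Metric.ball_mem_nhds t (hr t)
  obtain ⟨ρ, hρ, hT'⟩ := lebesgue_number_lemma_of_metric (s := (univ : Set I))
    (c := fun t : T => Metric.ball (t : I) (r t)) isCompact_univ (fun _ => Metric.isOpen_ball)
    (by simpa [Set.iUnion_subtype] using hT)
  obtain ⟨n, hn⟩ := exists_nat_one_div_lt hρ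
  have hn0 : (0 : ℝ) < n + 1 := by positivity
  let G := (Finset.range (n + 2)).image fun k : ℕ =>
    projIcc (0 : ℝ) 1 zero_le_one ((k : ℝ) / (n + 1))
  have hG : ∀ k : ℕ, ∀ h : (k : ℝ) / (n + 1) ∈ I, (⟨_, h⟩ : I) ∈ G := fun k h => by
    refine Finset.mem_image.2 ⟨k, Finset.mem_range.2 ?_, projIcc_of_mem _ h⟩
    have h1 := (div_le_one hn0).1 h.2
    have : k ≤ n + 1 := by exact_mod_cast h1
    omega
  refine ⟨G ∪ T, Finset.mem_union_left _ ?_, Finset.mem_union_left _ ?_, fun u w huw hQ => ?_⟩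
  · have := hG 0 (by simp)
    convert this using 1
    exact Subtype.ext (by simp)
  · have h1 : ((n + 1 : ℕ) : ℝ) / (n + 1) = 1 := by push_cast; exact div_self hn0.ne'
    have := hG (n + 1) (by rw [h1]; simp)
    convert this using 1
    exact Subtype.ext (by simpa using h1.symm)
  · have hclose : dist w u < ρ := by
      have huw' : (u : ℝ) ≤ w := huw
      rw [Subtype.dist_eq, Real.dist_eq, abs_of_nonneg (sub_nonneg.2 huw')]
      refine lt_of_le_of_lt ?_ hn
      by_contra! hlt
      have hu0 : (0 : ℝ) ≤ u := u.2.1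
      have h1 := Nat.floor_le (mul_nonneg hn0.le hu0)
      have h2 := Nat.lt_floor_add_one ((n + 1 : ℝ) * u)
      have h3 : ((⌊(n + 1 : ℝ) * u⌋₊ + 1 : ℕ) : ℝ) / (n + 1) ≤ w := by
        rw [div_le_iff₀ hn0]
        have := (div_lt_iff₀ hn0).1 hlt
        push_cast
        linarith
      have h4 : (u : ℝ) < ((⌊(n + 1 : ℝ) * u⌋₊ + 1 : ℕ) : ℝ) / (n + 1) := by
        rw [lt_div_iff₀ hn0]
        push_cast
        linarith
      have h5 := hQ _ (Finset.mem_union_left _ (hG _ ⟨hu0.trans h4.le, h3.trans w.2.2⟩)) h4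
      exact absurd h3 (not_le_of_gt h5)
    obtain ⟨t, ht⟩ := hT' u (mem_univ _)
    refine hx t u (ht (Metric.mem_ball_self hρ)) w (ht hclose) ?_ huw
    rcases lt_or_ge u t with h | h
    · exact Or.inl (hQ _ (Finset.mem_union_right _ t.2) h)
    · exact Or.inr h

theorem exists_sparsePartition [PseudoEMetricSpace S] (x : Cadlag S) {ε : ℝ≥0∞} (hε : 0 < ε) :
    ∃ δ : ℝ, 0 < δ ∧ ∃ p : SparsePartition δ, ∀ i : Fin p.v,
      ∀ u ∈ Ico (p.pt i.castSucc) (p.pt i.succ), ∀ w ∈ Ico (p.pt i.castSucc) (p.pt i.succ),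
        edist (x u) (x w) < ε := by
  obtain ⟨Q, h0, h1, hQ⟩ := x.exists_finset_edist_lt hε
  obtain ⟨δ, hδ, p, hp⟩ := SparsePartition.exists_of_finset Q h0 h1
  refine ⟨δ, hδ, p, fun i u hu w hw => ?_⟩
  have key : ∀ u ∈ Ico (p.pt i.castSucc) (p.pt i.succ),
      ∀ w ∈ Ico (p.pt i.castSucc) (p.pt i.succ), u ≤ w → edist (x u) (x w) < ε := by
    intro u hu w hw huw
    refine hQ u w huw fun q hq huq => ?_
    obtain ⟨j, rfl⟩ := hp q hq
    have : i.castSucc < j := p.strictMono.lt_iff_lt.1 (hu.1.trans_lt huq)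
    exact hw.2.trans_le (p.strictMono.monotone (Fin.castSucc_lt_iff_succ_le.1 this))
  rcases le_total u w with h | h
  · exact key u hu w hw h
  · rw [edist_comm]
    exact key w hw u hu h

/-- The time changes with small `c`-cost are uniformly close to the identity. -/
def ControlsSup (c : TimeChange → ℝ≥0∞) : Prop :=
  ∀ ε : ℝ, 0 < ε → ∃ η : ℝ≥0∞, 0 < η ∧
    ∀ γ : TimeChange, c γ < η → ∀ t : I, |(γ t : ℝ) - (t : ℝ)| < ε

theorem exists_modulus_le_of_skorohodEDist_lt [PseudoEMetricSpace S] {c : TimeChange → ℝ≥0∞}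
    (hc : ControlsSup c) (x₀ : Cadlag S) {ε : ℝ≥0∞} (hε : 0 < ε) :
    ∃ r > 0, ∃ δ : ℝ, 0 < δ ∧ ∀ x, skorohodEDist c x x₀ < r → x.modulus δ ≤ ε := by
  have hε3 : 0 < ε / 3 := ENNReal.div_pos hε.ne' (by simp)
  obtain ⟨δ, hδ, p, hp⟩ := x₀.exists_sparsePartition hε3
  obtain ⟨η, hη, hsmall⟩ := hc (δ / 4) (by linarith)
  refine ⟨min η (ε / 3), lt_min hη hε3, δ - 2 * (δ / 4), by linarith, fun x hx => ?_⟩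
  obtain ⟨γ, hγc, hγ⟩ := exists_of_skorohodEDist_lt hx
  have hγ' : ∀ t, |(γ.symm t : ℝ) - t| ≤ δ / 4 := fun t => by
    have := hsmall γ (hγc.trans_le (min_le_left _ _)) (γ.symm t)
    rw [OrderIso.apply_symm_apply, abs_sub_comm] at this
    exact this.le
  refine modulus_le (p.map γ.symm hγ') fun i u hu w hw => ?_
  have hmem : ∀ u ∈ Ico ((p.map γ.symm hγ').pt i.castSucc) ((p.map γ.symm hγ').pt i.succ),
      γ u ∈ Ico (p.pt i.castSucc) (p.pt i.succ) := fun u hu =>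
    ⟨(OrderIso.symm_apply_le γ).1 hu.1, (OrderIso.lt_symm_apply γ).1 hu.2⟩
  calc edist (x u) (x w)
      ≤ edist (x u) (x₀ (γ u)) + edist (x₀ (γ u)) (x₀ (γ w)) + edist (x₀ (γ w)) (x w) :=
        edist_triangle4 _ _ _ _
    _ ≤ ε / 3 + ε / 3 + ε / 3 := by
        rw [edist_comm (x₀ (γ w))]
        exact add_le_add (add_le_add ((hγ u).le.trans (min_le_right _ _))
          (hp i _ (hmem u hu) _ (hmem w hw)).le) ((hγ w).le.trans (min_le_right _ _))
    _ = ε := ENNReal.add_thirds _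

theorem exists_finite_values_of_skorohodEDist_lt [PseudoEMetricSpace S] {c : TimeChange → ℝ≥0∞}
    (x₀ : Cadlag S) {ε : ℝ≥0∞} (hε : 0 < ε) :
    ∃ r > 0, ∃ F : Set S, F.Finite ∧
      ∀ x, skorohodEDist c x x₀ < r → ∀ t, ∃ y ∈ F, edist (x t) y < ε := by
  have hε2 : 0 < ε / 2 := ENNReal.div_pos hε.ne' (by simp)
  obtain ⟨δ, hδ, p, hp⟩ := x₀.exists_sparsePartition hε2
  refine ⟨ε / 2, hε2, range fun j => x₀ (p.pt j), finite_range _, fun x hx t => ?_⟩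
  obtain ⟨γ, -, hγ⟩ := exists_of_skorohodEDist_lt hx
  have key : ∃ j, edist (x₀ (γ t)) (x₀ (p.pt j)) < ε / 2 := by
    rcases eq_or_lt_of_le (show γ t ≤ 1 from (γ t).2.2) with h | h
    · exact ⟨Fin.last _, by rw [h, p.last, edist_self]; exact hε2⟩
    · obtain ⟨i, hi⟩ := p.exists_mem_Ico h
      exact ⟨i.castSucc, hp i _ hi _ ⟨le_rfl, p.strictMono Fin.castSucc_lt_succ⟩⟩
  obtain ⟨j, hj⟩ := key
  refine ⟨_, mem_range_self j, (edist_triangle _ (x₀ (γ t)) _).trans_lt ?_⟩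
  rw [← ENNReal.add_halves ε]
  exact ENNReal.add_lt_add (hγ t) hj

section Compact

variable [PseudoEMetricSpace S] [m : EMetricSpace (Cadlag S)] {c : TimeChange → ℝ≥0∞}
  {K : Set (Cadlag S)}

/-- The modulus tends to zero uniformly on compact sets of a Skorohod-type metric. -/
theorem exists_modulus_le_of_isCompact (hm : ∀ x y : Cadlag S, edist x y = skorohodEDist c x y)
    (hc : ControlsSup c) (hK : IsCompact K) {ε : ℝ≥0∞} (hε : 0 < ε) :
    ∃ δ : ℝ, 0 < δ ∧ ∀ x ∈ K, x.modulus δ ≤ ε := by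
  refine hK.induction_on (p := fun s => ∃ δ : ℝ, 0 < δ ∧ ∀ x ∈ s, x.modulus δ ≤ ε)
    ⟨1, one_pos, by simp⟩ (fun s t hst ⟨δ, hδ, h⟩ => ⟨δ, hδ, fun x hx => h x (hst hx)⟩) ?_ ?_
  · rintro s t ⟨δ, hδ, h⟩ ⟨δ', hδ', h'⟩
    refine ⟨min δ δ', lt_min hδ hδ', fun x hx => ?_⟩
    rcases hx with hx | hx
    · exact (x.modulus_mono (min_le_left _ _)).trans (h x hx)
    · exact (x.modulus_mono (min_le_right _ _)).trans (h' x hx)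
  · intro x₀ _
    obtain ⟨r, hr, δ, hδ, h⟩ := exists_modulus_le_of_skorohodEDist_lt hc x₀ hε
    exact ⟨Metric.eball x₀ r, mem_nhdsWithin_of_mem_nhds (Metric.eball_mem_nhds x₀ hr), δ, hδ,
      fun x hx => h x (hm x x₀ ▸ hx)⟩

/-- The values of the members of a compact set form a totally bounded set. -/
theorem exists_finite_values_of_isCompact (hm : ∀ x y : Cadlag S, edist x y = skorohodEDist c x y)
    (hK : IsCompact K) {ε : ℝ≥0∞} (hε : 0 < ε) :
    ∃ F : Set S, F.Finite ∧ ∀ x ∈ K, ∀ t, ∃ y ∈ F, edist (x t) y < ε := by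
  refine hK.induction_on
    (p := fun s => ∃ F : Set S, F.Finite ∧ ∀ x ∈ s, ∀ t, ∃ y ∈ F, edist (x t) y < ε)
    ⟨∅, finite_empty, by simp⟩ (fun s t hst ⟨F, hF, h⟩ => ⟨F, hF, fun x hx => h x (hst hx)⟩) ?_ ?_
  · rintro s t ⟨F, hF, h⟩ ⟨F', hF', h'⟩
    refine ⟨F ∪ F', hF.union hF', fun x hx t => ?_⟩
    rcases hx with hx | hx
    · obtain ⟨y, hy, h⟩ := h x hx t
      exact ⟨y, Or.inl hy, h⟩
    · obtain ⟨y, hy, h⟩ := h' x hx t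
      exact ⟨y, Or.inr hy, h⟩
  · intro x₀ _
    obtain ⟨r, hr, F, hF, h⟩ := exists_finite_values_of_skorohodEDist_lt (c := c) x₀ hε
    exact ⟨Metric.eball x₀ r, mem_nhdsWithin_of_mem_nhds (Metric.eball_mem_nhds x₀ hr), F, hF,
      fun x hx => h x (hm x x₀ ▸ hx)⟩

end Compact

/-- The grid point `j/N`, truncated to `[0,1]`. -/
noncomputable def gridPt (N j : ℕ) : I := projIcc (0 : ℝ) 1 zero_le_one ((j : ℝ) / N)

theorem coe_gridPt_floor (N : ℕ) (s : I) : (gridPt N ⌊(N : ℝ) * s⌋₊ : ℝ) = ⌊(N : ℝ) * s⌋₊ / N := by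
  rw [gridPt, projIcc_of_mem]
  have h1 := Nat.floor_le (mul_nonneg (Nat.cast_nonneg N : (0 : ℝ) ≤ N) s.2.1)
  exact ⟨by positivity, div_le_one_of_le₀
    (h1.trans (mul_le_of_le_one_right (Nat.cast_nonneg N) s.2.2)) (Nat.cast_nonneg N)⟩

/-- After a time change of small cost, a function with small modulus is nearly constant on the
intervals of the grid of mesh `1/N`. -/
theorem exists_timeChange_edist_gridPt_lt [PseudoEMetricSpace S] {x : Cadlag S} {δ η : ℝ}
    {ε : ℝ≥0∞} (hx : x.modulus δ < ε) (hδ : 0 < δ) {N : ℕ} (hN0 : 0 < N)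
    (hN : (1 / δ + 1) / (N * δ) ≤ 1 - Real.exp (-η)) :
    ∃ γ : TimeChange, TimeChange.logCost γ ≤ ENNReal.ofReal η ∧
      ∀ s : I, edist (x (γ.symm s)) (x (γ.symm (gridPt N ⌊(N : ℝ) * s⌋₊))) < ε := by
  obtain ⟨p, hp⟩ := exists_of_modulus_lt hx
  obtain ⟨γ, hγc, hγ⟩ := p.exists_timeChange_grid hδ hN0 hN
  have hNr : (0 : ℝ) < N := Nat.cast_pos.2 hN0
  refine ⟨γ, hγc, fun s => ?_⟩
  rcases eq_or_lt_of_le (show s ≤ 1 from s.2.2) with rfl | hs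
  · have h1 : gridPt N ⌊(N : ℝ) * (1 : I)⌋₊ = 1 := Subtype.ext (by
      rw [coe_gridPt_floor]; simp [hNr.ne'])
    rw [h1, edist_self]
    exact pos_of_gt hx
  · have hs' : γ.symm s < 1 := by
      rw [← show γ.symm 1 = 1 from map_top γ.symm]
      exact γ.symm.strictMono hs
    obtain ⟨i, hi⟩ := p.exists_mem_Ico hs'
    have hle : gridPt N ⌊(N : ℝ) * s⌋₊ ≤ s := by
      change (gridPt N ⌊(N : ℝ) * s⌋₊ : ℝ) ≤ s
      rw [coe_gridPt_floor, div_le_iff₀ hNr, mul_comm (s : ℝ)]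
      exact Nat.floor_le (mul_nonneg hNr.le s.2.1)
    refine hp i _ hi _ ⟨(OrderIso.le_symm_apply γ).2 ?_, (γ.symm.monotone hle).trans_lt hi.2⟩
    obtain ⟨k, hk⟩ := hγ i.castSucc
    have h1 : (γ (p.pt i.castSucc) : ℝ) ≤ s := (OrderIso.le_symm_apply γ).1 hi.1
    change (γ (p.pt i.castSucc) : ℝ) ≤ gridPt N ⌊(N : ℝ) * s⌋₊
    rw [hk, div_le_iff₀ hNr, mul_comm] at h1
    rw [coe_gridPt_floor, hk]
    exact div_le_div_of_nonneg_right (Nat.cast_le.2 (Nat.le_floor h1)) hNr.le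

theorem _root_.totallyBounded_of_finite_codes {α : Type*} [PseudoEMetricSpace α] {A : Set α}
    (h : ∀ ε : ℝ≥0∞, 0 < ε → ∃ (β : Type) (_ : Finite β) (R : α → β → Prop),
      (∀ x ∈ A, ∃ b, R x b) ∧ ∀ x ∈ A, ∀ y ∈ A, ∀ b, R x b → R y b → edist x y < ε) :
    TotallyBounded A := by
  rcases A.eq_empty_or_nonempty with rfl | ⟨x₀, hx₀⟩
  · exact totallyBounded_empty
  refine EMetric.totallyBounded_iff.2 fun ε hε => ?_
  obtain ⟨β, _, R, hR, hR'⟩ := h ε hε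
  have hrep : ∀ b, ∃ x ∈ A, (∃ y ∈ A, R y b) → R x b := fun b => by
    by_cases hb : ∃ y ∈ A, R y b
    · obtain ⟨y, hy, hyb⟩ := hb
      exact ⟨y, hy, fun _ => hyb⟩
    · exact ⟨x₀, hx₀, fun h => absurd h hb⟩
  choose rep hrepA hrep using hrep
  refine ⟨range rep, finite_range rep, fun x hx => ?_⟩
  obtain ⟨b, hb⟩ := hR x hx
  exact mem_iUnion₂.2 ⟨rep b, mem_range_self b, hR' x hx _ (hrepA b) b hb (hrep b ⟨x, hx, hb⟩)⟩

/-- Sufficient conditions for total boundedness in the complete Skorohod metric. -/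
theorem totallyBounded_logSkorohod [EMetricSpace S] {A : Set (Cadlag S)}
    (hT : ∀ ε : ℝ≥0∞, 0 < ε → ∃ F : Set S, F.Finite ∧ ∀ x ∈ A, ∀ t, ∃ y ∈ F, edist (x t) y < ε)
    (hw : ∀ ε : ℝ≥0∞, 0 < ε → ∃ δ : ℝ, 0 < δ ∧ ∀ x ∈ A, x.modulus δ < ε) :
    @TotallyBounded (Cadlag S) (logSkorohodMetric S).toUniformSpace A := by
  let _ := logSkorohodMetric S
  refine totallyBounded_of_finite_codes fun e he => ?_
  obtain ⟨e', he', hee⟩ := exists_between he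
  obtain ⟨η, hη, hηe⟩ : ∃ η : ℝ, 0 < η ∧ ENNReal.ofReal η + ENNReal.ofReal η ≤ e' := by
    have h0 : Tendsto (fun η : ℝ => ENNReal.ofReal η + ENNReal.ofReal η) (𝓝[>] 0) (𝓝 0) := by
      have h1 : Tendsto ENNReal.ofReal (𝓝[>] 0) (𝓝 0) := by
        simpa using (ENNReal.continuous_ofReal.tendsto 0).mono_left nhdsWithin_le_nhds
      simpa using h1.add h1
    obtain ⟨η, h, h'⟩ := ((h0.eventually_lt_const he').and self_mem_nhdsWithin).exists
    exact ⟨η, h', h.le⟩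
  have hε : 0 < e' / 2 / 2 :=
    ENNReal.div_pos (ENNReal.div_pos he'.ne' (by simp)).ne' (by simp)
  obtain ⟨F, hF, hFA⟩ := hT _ hε
  obtain ⟨δ, hδ, hδA⟩ := hw _ hε
  obtain ⟨N, hN0, hN⟩ : ∃ N : ℕ, 0 < N ∧ (1 / δ + 1) / (N * δ) ≤ 1 - Real.exp (-η) := by
    have hpos : 0 < 1 - Real.exp (-η) := sub_pos.2 (Real.exp_lt_one_iff.2 (by linarith))
    obtain ⟨N, hN⟩ := exists_nat_gt ((1 / δ + 1) / δ / (1 - Real.exp (-η)))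
    have hN0 : (0 : ℝ) < N := lt_of_le_of_lt (by positivity) hN
    refine ⟨N, Nat.cast_pos.1 hN0, ?_⟩
    rw [mul_comm, ← div_div, div_le_iff₀ hN0, mul_comm]
    exact ((div_lt_iff₀ hpos).1 hN).le
  obtain ⟨n, f, hf⟩ : ∃ (n : ℕ) (f : Fin n → S), range f = F := by
    obtain ⟨n, f, -, hf⟩ := hF.fin_param
    exact ⟨n, f, hf⟩
  refine ⟨Fin (N + 1) → Fin n, inferInstance, fun x b => ∃ γ : TimeChange,
    TimeChange.logCost γ ≤ ENNReal.ofReal η ∧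
      ∀ s : I, ∀ h : ⌊(N : ℝ) * s⌋₊ < N + 1,
        edist (x (γ.symm s)) (f (b ⟨⌊(N : ℝ) * s⌋₊, h⟩)) ≤ e' / 2, fun x hx => ?_, ?_⟩
  · obtain ⟨γ, hγc, hγ⟩ := exists_timeChange_edist_gridPt_lt (hδA x hx) hδ hN0 hN
    have hb : ∀ j : Fin (N + 1), ∃ k, edist (x (γ.symm (gridPt N j))) (f k) < e' / 2 / 2 :=
      fun j => by
        obtain ⟨y, hy, h⟩ := hFA x hx (γ.symm (gridPt N j))
        obtain ⟨k, rfl⟩ := hf.symm ▸ hy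
        exact ⟨k, h⟩
    choose b hb using hb
    refine ⟨b, γ, hγc, fun s h => ?_⟩
    rw [← ENNReal.add_halves (e' / 2)]
    exact (edist_triangle _ _ _).trans (add_le_add (hγ s).le (hb ⟨_, h⟩).le)
  · rintro x - y - b ⟨γ, hγc, hγ⟩ ⟨κ, hκc, hκ⟩
    refine lt_of_le_of_lt (skorohodEDist_le (γ.trans κ.symm) ?_ fun t => ?_) hee
    · exact (TimeChange.logCost_trans _ _).trans
        ((add_le_add hγc ((TimeChange.logCost_symm κ).trans hκc)).trans hηe)
    · have hlt : ⌊(N : ℝ) * (γ t)⌋₊ < N + 1 := by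
        refine Nat.lt_succ_of_le (Nat.floor_le_of_le ?_)
        exact mul_le_of_le_one_right (Nat.cast_nonneg N) (γ t).2.2
      have h1 := hγ (γ t) hlt
      rw [OrderIso.symm_apply_apply] at h1
      rw [← ENNReal.add_halves e']
      exact (edist_triangle_right _ _ _).trans (add_le_add h1 (hκ (γ t) hlt))

end Cadlag

section Tight

variable {X ι : Type*} [TopologicalSpace X] [MeasurableSpace X]

/-- Sets that are eventually disjoint from every compact set have asymptotically zero outer
measure. -/
theorem eventually_measure_le_of_disjoint_isCompact [FirstCountableTopology X]
    [OpensMeasurableSpace X] (μ : Measure X) [IsFiniteMeasure μ] {E : ι → Set X} {l : Filter ι}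
    [l.IsCountablyGenerated] (h : ∀ K, IsCompact K → ∀ᶠ a in l, Disjoint (E a) K) {η : ℝ≥0∞}
    (hη : 0 < η) : ∀ᶠ a in l, μ (E a) ≤ η := by
  by_contra hcon
  obtain ⟨a, hal, ha⟩ := exists_seq_forall_of_frequently (not_eventually.1 hcon)
  let F : ℕ → Set X := fun k => closure (⋃ j ≥ k, E (a j))
  have hF : Antitone F := fun k k' hk => closure_mono
    (biUnion_subset_biUnion_left fun j hj => le_trans hk hj)
  have hempty : ⋂ k, F k = ∅ := by
    refine eq_empty_of_forall_notMem fun x hx => ?_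
    obtain ⟨u, hu⟩ := (𝓝 x).exists_antitone_basis
    have hy : ∀ k, ∃ y ∈ u k, ∃ j ≥ k, y ∈ E (a j) := fun k => by
      obtain ⟨y, hyu, hy⟩ := mem_closure_iff_nhds.1 (mem_iInter.1 hx k) (u k) (hu.1.mem_of_mem trivial)
      obtain ⟨j, hj, hyj⟩ := mem_iUnion₂.1 hy
      exact ⟨y, hyu, j, hj, hyj⟩
    choose y hyu j hj hyE using hy
    have hK := (hu.tendsto hyu).isCompact_insert_range
    obtain ⟨n, hn⟩ := eventually_atTop.1 (hal.eventually (h _ hK))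
    exact Set.disjoint_left.1 (hn (j n) (hj n)) (hyE n) (Or.inr (mem_range_self n))
  have hlim := tendsto_measure_iInter_atTop (μ := μ)
    (fun k => (isClosed_closure : IsClosed (F k)).measurableSet.nullMeasurableSet) hF
    ⟨0, measure_ne_top _ _⟩
  rw [hempty, measure_empty] at hlim
  obtain ⟨k, hk⟩ := (hlim.eventually_lt_const hη).exists
  refine ha k (le_trans (measure_mono ?_) hk.le)
  exact subset_closure.trans' (subset_biUnion_of_mem (u := fun j => E (a j)) (le_refl k))

theorem IsTightMeasureSet.tendsto_limsup_measure {P : ℕ → Measure X}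
    (hP : IsTightMeasureSet (range P)) {E : ι → Set X} {l : Filter ι}
    (h : ∀ K, IsCompact K → ∀ᶠ a in l, Disjoint (E a) K) :
    Tendsto (fun a => limsup (fun n => P n (E a)) atTop) l (𝓝 0) := by
  refine ENNReal.tendsto_nhds_zero.2 fun ε hε => ?_
  obtain ⟨K, hK, hKP⟩ := isTightMeasureSet_iff_exists_isCompact_measure_compl_le.1 hP ε hε
  filter_upwards [h K hK] with a ha
  refine limsup_le_of_le (h := Eventually.of_forall fun n => ?_)
  exact (measure_mono ha.subset_compl_right).trans (hKP _ (mem_range_self n))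

theorem exists_forall_measure_le [FirstCountableTopology X] [OpensMeasurableSpace X]
    {P : ℕ → Measure X} (hP : ∀ n, IsProbabilityMeasure (P n)) {E : ι → Set X} {l : Filter ι}
    [l.NeBot] [l.IsCountablyGenerated] (h : ∀ K, IsCompact K → ∀ᶠ a in l, Disjoint (E a) K)
    (hE : ∀ᶠ a in l, ∀ᶠ b in l, E b ⊆ E a)
    (hlim : Tendsto (fun a => limsup (fun n => P n (E a)) atTop) l (𝓝 0)) {η : ℝ≥0∞}
    (hη : 0 < η) : ∀ᶠ a in l, ∀ n, P n (E a) ≤ η := by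
  obtain ⟨a, ha, haE⟩ := ((hlim.eventually_lt_const hη).and hE).exists
  obtain ⟨N, hN⟩ := eventually_atTop.1 (eventually_lt_of_limsup_lt ha)
  have hfin : ∀ᶠ b in l, ∀ n ∈ Finset.range N, P n (E b) ≤ η :=
    (Finset.eventually_all _).2 fun n _ => eventually_measure_le_of_disjoint_isCompact (P n) h hη
  filter_upwards [haE, hfin] with b hb hb' n
  rcases lt_or_ge n N with hn | hn
  · exact hb' n (Finset.mem_range.2 hn)
  · exact (measure_mono hb).trans (hN n hn).le

theorem eventually_eventually_subset_of_monotone {X : Type*} {E : ℝ → Set X} (hE : Monotone E) :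
    ∀ᶠ a in 𝓝[>] (0 : ℝ), ∀ᶠ b in 𝓝[>] (0 : ℝ), E b ⊆ E a := by
  filter_upwards [self_mem_nhdsWithin] with a ha
  filter_upwards [Ioo_mem_nhdsGT ha] with b hb
  exact hE hb.2.le

end Tight

theorem TotallyBounded.exists_isCompact_image_subset {α β : Type*} [UniformSpace α]
    [CompleteSpace α] [TopologicalSpace β] {f : α → β} (hf : Continuous f) {A : Set α}
    (hA : TotallyBounded A) : ∃ K, IsCompact K ∧ f '' A ⊆ K :=
  ⟨_, (hA.closure.isCompact_of_isClosed isClosed_closure).image hf, image_mono subset_closure⟩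

instance SkorohodD.instCompleteSpace : CompleteSpace SkorohodD :=
  Cadlag.completeSpace_logSkorohod

namespace SkorohodDD

variable {K A : Set SkorohodDD}

theorem exists_finite_values (hK : IsCompact K) {ε : ℝ≥0∞} (hε : 0 < ε) :
    ∃ F : Set SkorohodD, F.Finite ∧ ∀ x ∈ K, ∀ t, ∃ y ∈ F, edist (x t) y < ε :=
  Cadlag.exists_finite_values_of_isCompact (m := SkorohodDD.instEMetricSpace)
    (c := TimeChange.supCost) (fun _ _ => rfl) hK hε

/-- The values of the members of a compact set lie in a compact set. -/
theorem exists_isCompact_values (hK : IsCompact K) :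
    ∃ V : Set SkorohodD, IsCompact V ∧ ∀ x ∈ K, ∀ t, x t ∈ V := by
  refine ⟨closure {y | ∃ x ∈ K, ∃ t, x t = y}, ?_, fun x hx t => subset_closure ⟨x, hx, t, rfl⟩⟩
  refine (TotallyBounded.closure ?_).isCompact_of_isClosed isClosed_closure
  refine EMetric.totallyBounded_iff.2 fun ε hε => ?_
  obtain ⟨F, hF, h⟩ := exists_finite_values hK hε
  refine ⟨F, hF, ?_⟩
  rintro _ ⟨x, hx, t, rfl⟩
  obtain ⟨y, hy, hxy⟩ := h x hx t
  exact mem_iUnion₂.2 ⟨y, hy, hxy⟩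

theorem exists_superNorm_le (hK : IsCompact K) :
    ∃ M : ℝ, ∀ x ∈ K, superNorm x ≤ ENNReal.ofReal M := by
  obtain ⟨V, hV, hKV⟩ := exists_isCompact_values hK
  obtain ⟨F, hF, h⟩ := Cadlag.exists_finite_values_of_isCompact (m := SkorohodD.instEMetricSpace)
    (c := TimeChange.logCost) (fun _ _ => rfl) hV one_pos
  obtain ⟨M, hM⟩ := hF.isBounded.exists_norm_le
  refine ⟨M + 1, fun x hx => iSup₂_le fun t s => ENNReal.ofReal_le_ofReal ?_⟩
  obtain ⟨r, hr, hrs⟩ := h (x t) (hKV x hx t) s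
  have h1 := hM r hr
  rw [edist_dist, ← ENNReal.ofReal_one, ENNReal.ofReal_lt_ofReal_iff one_pos, Real.dist_eq] at hrs
  rw [Real.norm_eq_abs] at h1
  have h2 := abs_add_le (x t s - r) r
  rw [sub_add_cancel] at h2
  linarith

theorem eventually_disjoint_superNorm (hK : IsCompact K) :
    ∀ᶠ a : ℝ in atTop, Disjoint {x : SkorohodDD | ENNReal.ofReal a ≤ x.superNorm} K := by
  obtain ⟨M, hM⟩ := exists_superNorm_le hK
  filter_upwards [eventually_gt_atTop (max M 0)] with a ha
  refine Set.disjoint_left.2 fun x hxa hxK => ?_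
  refine absurd (le_trans hxa (hM x hxK)) (not_le_of_gt ?_)
  exact (ENNReal.ofReal_lt_ofReal_iff ((le_max_right _ _).trans_lt ha)).2
    ((le_max_left _ _).trans_lt ha)

theorem eventually_disjoint_modulus_apply (hK : IsCompact K) {ε : ℝ} (hε : 0 < ε) :
    ∀ᶠ δ : ℝ in 𝓝[>] 0,
      Disjoint {x : SkorohodDD | ∃ t : I, ENNReal.ofReal ε ≤ (x t).modulus δ} K := by
  obtain ⟨V, hV, hKV⟩ := exists_isCompact_values hK
  obtain ⟨δ₀, hδ₀, h⟩ := Cadlag.exists_modulus_le_of_isCompact (m := SkorohodD.instEMetricSpace)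
    (fun _ _ => rfl) TimeChange.logCost_small hV (ENNReal.ofReal_pos.2 (half_pos hε))
  filter_upwards [mem_nhdsWithin_of_mem_nhds (eventually_lt_nhds hδ₀)] with δ hδ
  refine Set.disjoint_left.2 ?_
  rintro x ⟨t, ht⟩ hxK
  refine absurd ((ht.trans ((x t).modulus_mono (le_of_lt hδ))).trans (h _ (hKV x hxK t)))
    (not_le_of_gt ?_)
  exact (ENNReal.ofReal_lt_ofReal_iff hε).2 (half_lt_self hε)

theorem eventually_disjoint_modulus (hK : IsCompact K) {ε : ℝ} (hε : 0 < ε) :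
    ∀ᶠ δ : ℝ in 𝓝[>] 0, Disjoint {x : SkorohodDD | ENNReal.ofReal ε ≤ Cadlag.modulus x δ} K := by
  obtain ⟨δ₀, hδ₀, h⟩ := Cadlag.exists_modulus_le_of_isCompact (m := SkorohodDD.instEMetricSpace)
    (fun _ _ => rfl) TimeChange.supCost_small hK (ENNReal.ofReal_pos.2 (half_pos hε))
  filter_upwards [mem_nhdsWithin_of_mem_nhds (eventually_lt_nhds hδ₀)] with δ hδ
  refine Set.disjoint_left.2 fun x hx hxK => ?_
  refine absurd ((le_trans hx (Cadlag.modulus_mono x (le_of_lt hδ))).trans (h _ hxK))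
    (not_le_of_gt ?_)
  exact (ENNReal.ofReal_lt_ofReal_iff hε).2 (half_lt_self hε)

theorem continuous_logSkorohod_to_sup :
    @Continuous SkorohodDD SkorohodDD
      (Cadlag.logSkorohodMetric SkorohodD).toUniformSpace.toTopologicalSpace
      SkorohodDD.instEMetricSpace.toUniformSpace.toTopologicalSpace id := by
  refine @continuous_iff_continuousAt _ _ (_) (_) _ |>.2 fun x => ?_
  refine (@EMetric.tendsto_nhds_nhds _ _ (Cadlag.logSkorohodMetric SkorohodD).toPseudoEMetricSpace
    SkorohodDD.instEMetricSpace.toPseudoEMetricSpace _ _ _).2 fun ε hε => ?_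
  obtain ⟨e, he, heε⟩ := exists_between hε
  have he' : e ≠ ⊤ := heε.ne_top
  obtain ⟨η, hη, hsmall⟩ := TimeChange.logCost_small e.toReal (ENNReal.toReal_pos he.ne' he')
  refine ⟨min η e, lt_min hη he, fun y hy => ?_⟩
  obtain ⟨γ, hγc, hγ⟩ := Cadlag.exists_of_skorohodEDist_lt hy
  refine (Cadlag.skorohodEDist_le γ (iSup_le fun t => ?_)
    fun t => (hγ t).le.trans (min_le_right _ _)).trans_lt heε
  exact ENNReal.ofReal_le_of_le_toReal (hsmall γ (hγc.trans_le (min_le_left _ _)) t).le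

/-- Sufficient conditions for relative compactness in `D([0,1]; D)`. -/
theorem exists_isCompact_superset {a : ℝ} (ha : ∀ x ∈ A, superNorm x ≤ ENNReal.ofReal a)
    (h₁ : ∀ ε : ℝ≥0∞, 0 < ε → ∃ δ : ℝ, 0 < δ ∧ ∀ x ∈ A, ∀ t, (x t).modulus δ < ε)
    (h₂ : ∀ ε : ℝ≥0∞, 0 < ε → ∃ δ : ℝ, 0 < δ ∧ ∀ x ∈ A, Cadlag.modulus x δ < ε) :
    ∃ K, IsCompact K ∧ A ⊆ K := by
  have hval : TotallyBounded {y : SkorohodD | ∃ x ∈ A, ∃ t, x t = y} := by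
    refine Cadlag.totallyBounded_logSkorohod (fun ε hε => ?_) fun ε hε => ?_
    · obtain ⟨F, hF, h⟩ := EMetric.totallyBounded_iff.1
        (isCompact_Icc (a := -(max a 0)) (b := max a 0)).totallyBounded ε hε
      refine ⟨F, hF, ?_⟩
      rintro _ ⟨x, hx, t, rfl⟩ s
      have hxs : ENNReal.ofReal |x t s| ≤ ENNReal.ofReal a :=
        le_trans (le_iSup₂_of_le t s le_rfl) (ha x hx)
      have hxs' : |x t s| ≤ max a 0 := by
        rw [← ENNReal.ofReal_le_ofReal_iff (le_max_right _ _)]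
        exact hxs.trans (ENNReal.ofReal_le_ofReal (le_max_left _ _))
      obtain ⟨y, hy, hxy⟩ := mem_iUnion₂.1 (h (abs_le.1 hxs'))
      exact ⟨y, hy, hxy⟩
    · obtain ⟨δ, hδ, h⟩ := h₁ ε hε
      refine ⟨δ, hδ, ?_⟩
      rintro _ ⟨x, hx, t, rfl⟩
      exact h x hx t
  have hA : @TotallyBounded SkorohodDD (Cadlag.logSkorohodMetric SkorohodD).toUniformSpace A := by
    refine Cadlag.totallyBounded_logSkorohod (fun ε hε => ?_) h₂
    obtain ⟨F, hF, h⟩ := EMetric.totallyBounded_iff.1 hval ε hε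
    refine ⟨F, hF, fun x hx t => ?_⟩
    obtain ⟨y, hy, hxy⟩ := mem_iUnion₂.1 (h ⟨x, hx, t, rfl⟩)
    exact ⟨y, hy, hxy⟩
  have h := @TotallyBounded.exists_isCompact_image_subset _ _ (_) Cadlag.completeSpace_logSkorohod (_) _
    continuous_logSkorohod_to_sup _ hA
  rwa [image_id] at h

end SkorohodDD

theorem mainTheorem1 (P : ℕ → Measure SkorohodDD) (hP : ∀ n, IsProbabilityMeasure (P n)) :
    IsTightMeasureSet (Set.range P) ↔
      (Tendsto (fun a : ℝ =>
          limsup (fun n => P n {x : SkorohodDD | ENNReal.ofReal a ≤ x.superNorm}) atTop)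
        atTop (𝓝 0)) ∧
      (∀ ε : ℝ, 0 < ε → Tendsto (fun δ : ℝ =>
          limsup (fun n => P n {x : SkorohodDD |
            ∃ t : I, ENNReal.ofReal ε ≤ Cadlag.modulus (x t) δ}) atTop)
        (𝓝[>] 0) (𝓝 0)) ∧
      (∀ ε : ℝ, 0 < ε → Tendsto (fun δ : ℝ =>
          limsup (fun n => P n {x : SkorohodDD | ENNReal.ofReal ε ≤ Cadlag.modulus x δ}) atTop)
        (𝓝[>] 0) (𝓝 0)) := by
  constructor
  · intro h
    exact ⟨IsTightMeasureSet.tendsto_limsup_measure h fun K hK =>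
        SkorohodDD.eventually_disjoint_superNorm hK,
      fun ε hε => IsTightMeasureSet.tendsto_limsup_measure h fun K hK =>
        SkorohodDD.eventually_disjoint_modulus_apply hK hε,
      fun ε hε => IsTightMeasureSet.tendsto_limsup_measure h fun K hK =>
        SkorohodDD.eventually_disjoint_modulus hK hε⟩
  rintro ⟨h₁, h₂, h₃⟩
  refine isTightMeasureSet_iff_exists_isCompact_measure_compl_le.2 fun ε hε => ?_
  have hε3 : 0 < ε / 3 := ENNReal.div_pos hε.ne' (by simp)
  obtain ⟨e, he, hsum⟩ := ENNReal.exists_pos_sum_of_countable' hε3.ne' ℕ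
  have hr : ∀ k : ℕ, (0 : ℝ) < 1 / (k + 1) := fun k => by positivity
  obtain ⟨a, ha⟩ := (exists_forall_measure_le hP
    (fun K hK => SkorohodDD.eventually_disjoint_superNorm hK)
    (Eventually.of_forall fun a => (eventually_ge_atTop a).mono fun b hb x hx =>
      (ENNReal.ofReal_le_ofReal hb).trans hx) h₁ hε3).exists
  have h₂' : ∀ k : ℕ, ∃ δ : ℝ, 0 < δ ∧ ∀ n, P n {x : SkorohodDD |
      ∃ t : I, ENNReal.ofReal (1 / (k + 1)) ≤ Cadlag.modulus (x t) δ} ≤ e k := fun k => by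
    obtain ⟨δ, h, h'⟩ := ((exists_forall_measure_le hP
      (fun K hK => SkorohodDD.eventually_disjoint_modulus_apply hK (hr k))
      (eventually_eventually_subset_of_monotone fun _ _ hδ x ⟨t, ht⟩ =>
        ⟨t, ht.trans ((x t).modulus_mono hδ)⟩) (h₂ _ (hr k)) (he k)).and
      self_mem_nhdsWithin).exists
    exact ⟨δ, h', h⟩
  have h₃' : ∀ k : ℕ, ∃ δ : ℝ, 0 < δ ∧ ∀ n, P n {x : SkorohodDD |
      ENNReal.ofReal (1 / (k + 1)) ≤ Cadlag.modulus x δ} ≤ e k := fun k => by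
    obtain ⟨δ, h, h'⟩ := ((exists_forall_measure_le hP
      (fun K hK => SkorohodDD.eventually_disjoint_modulus hK (hr k))
      (eventually_eventually_subset_of_monotone fun _ _ hδ x hx =>
        le_trans hx (Cadlag.modulus_mono x hδ)) (h₃ _ (hr k)) (he k)).and
      self_mem_nhdsWithin).exists
    exact ⟨δ, h', h⟩
  choose δ hδ hPδ using h₂'
  choose δ' hδ' hPδ' using h₃'
  let B : Set SkorohodDD := {x | ENNReal.ofReal a ≤ x.superNorm} ∪
    (⋃ k : ℕ, {x | ∃ t : I, ENNReal.ofReal (1 / (k + 1)) ≤ Cadlag.modulus (x t) (δ k)}) ∪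
    ⋃ k : ℕ, {x | ENNReal.ofReal (1 / (k + 1)) ≤ Cadlag.modulus x (δ' k)}
  have hB : ∀ n, P n B ≤ ε := fun n => by
    refine (measure_union_le _ _).trans ((add_le_add (measure_union_le _ _) le_rfl).trans ?_)
    rw [← ENNReal.add_thirds ε]
    refine add_le_add (add_le_add (ha n) ?_) ?_
    · exact (measure_iUnion_le _).trans ((ENNReal.tsum_le_tsum fun k => hPδ k n).trans hsum.le)
    · exact (measure_iUnion_le _).trans ((ENNReal.tsum_le_tsum fun k => hPδ' k n).trans hsum.le)
  have hsmall : ∀ ε : ℝ≥0∞, 0 < ε → ∃ k : ℕ, ENNReal.ofReal (1 / (k + 1)) < ε := fun ε hε => by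
    have : Tendsto (fun k : ℕ => ENNReal.ofReal (1 / (k + 1))) atTop (𝓝 0) := by
      simpa using ENNReal.tendsto_ofReal tendsto_one_div_add_atTop_nhds_zero_nat
    exact (this.eventually_lt_const hε).exists
  obtain ⟨K, hK, hBK⟩ := SkorohodDD.exists_isCompact_superset (A := Bᶜ) (a := a)
    (fun x hx => le_of_not_ge fun h => hx (Or.inl (Or.inl h)))
    (fun ε hε => by
      obtain ⟨k, hk⟩ := hsmall ε hε
      exact ⟨δ k, hδ k, fun x hx t => (lt_of_not_ge fun h =>
        hx (Or.inl (Or.inr (mem_iUnion.2 ⟨k, t, h⟩)))).trans hk⟩)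
    (fun ε hε => by
      obtain ⟨k, hk⟩ := hsmall ε hε
      exact ⟨δ' k, hδ' k, fun x hx => (lt_of_not_ge fun h =>
        hx (Or.inr (mem_iUnion.2 ⟨k, h⟩))).trans hk⟩)
  refine ⟨K, hK, ?_⟩
  rintro _ ⟨n, rfl⟩
  exact (measure_mono (compl_subset_comm.1 hBK)).trans (hB n)
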